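/- Let $H$ be a complex Hilbert space with inner product $(\cdot,\cdot)$ and norm $\|\cdot\|$. Let $\mathbf a[\cdot,\cdot]$ be a Hermitian sesquilinear form on a dense subspace $H^1\subset H$, with quadratic form $\mathbf a[u]=\mathbf a[u,u]$, which is closed and positive in the sense that $\mathbf a[u]\ge c\|u\|^2$ for all $u\in H^1$, with some constant $c>0$. Consider $H^1$ as a Hilbert space with the inner product $\mathbf a[\cdot,\cdot]$, and let $H^1_0$ be a closed subspace of $H^1$ that is dense in $H$. Let $A_{\mathrm N}$ and $A_{\mathrm D}$ be the self-adjoint operators in $H$ generated by $\mathbf a$ on $H^1$ and by the restriction of $\mathbf a$ to $H^1_0$, respectively. For $\lambda\in\mathbb R$ and $\mathrm B\in\{\mathrm N,\mathrm D\}$ put: * $N_{\mathrm B}(\lambda)=\dim\chi_{(-\infty,\lambda)}(A_{\mathrm B})H$, where $\chi_{(-\infty,\lambda)}(A_{\mathrm B})$ is the spectral projection of $A_{\mathrm B}$; * $\lambda_{\mathrm D,\infty}=\inf\sigma_{\mathrm{ess}}(A_{\mathrm D})$, the bottom of the essential spectrum ($+\infty$ if it is empty); * $n_{\mathrm D}(\lambda)=\dim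 E_{\mathrm D}(\lambda)\mathcal H$, where $E_{\mathrm D}(\lambda)$ is the orthogonal projection in $H$ onto $\ker(A_{\mathrm D}-\lambda)$ and $\mathcal H$ is the orthogonal complement in $H$ of the closed linear span of all common eigenvectors of $A_{\mathrm N}$ and $A_{\mathrm D}$; * $A$ is the operator whose domain $H^1_A$ is the set of $u\in H^1$ for which the functional $v\mapsto\mathbf a[u,v]$ on $H^1_0$ is continuous in the norm of $H$, with $(Au,v)=\mathbf a[u,v]$ for all $v\in H^1_0$; and $G_\lambda=\{u\in H^1_A: Au=\lambda u\}$, which is a closed subspace of $H^1$; * $\mathcal B_\lambda=(I-\lambda\Pi'_\lambda A_{\mathrm N}^{-1})|_{G_\lambda}$, where $\Pi'_\lambda$ is the $H^1$-orthogonal projection onto $G_\lambda$; this is a bounded self-adjoint operator in the Hilbert space $G_\lambda$ with the inner product $\mathbf a[\cdot,\cdot]$; * $G_\lambda^-=\chi_{(-\infty,0)}(\mathcal B_\lambda)G_\lambda$, the negative spectral subspace of $\mathcal B_\lambda$. Dimensions take values in $\{0,1,2,\dots\}\cup\{\infty\}$. Then, for every real $\lambda<\lambda_{\mathrm D,\infty}$,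 $$N_{\mathrm N}(\lambda)=N_{\mathrm D}(\lambda)+n_{\mathrm D}(\lambda)+\dim G_\lambda^-.$$ -/

import Mathlib

open Filter Topology ComplexConjugate

noncomputable section

/-- A densely defined, closed, positive (bounded below by a positive constant) Hermitian
sesquilinear form `a` in a complex Hilbert space `H`. Following Mathlib's convention for inner
products, forms are conjugate-linear in the first variable. -/
structure ClosedPosForm (H : Type*) [NormedAddCommGroup H] [InnerProductSpace ℂ H] where
  /-- the form domain -/
  domain : Submodule ℂ H
  dense_domain : Dense (domain : Set H)
  /-- the sesquilinear form -/
  form : domain →ₗ⋆[ℂ] domain →ₗ[ℂ] ℂ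
  conj_symm : ∀ u v, conj (form v u) = form u v
  pos : ∃ c : ℝ, 0 < c ∧ ∀ u : domain, c * ‖(u : H)‖ ^ 2 ≤ (form u u).re
  /-- if `uₙ → x` in `H` and `a[uₘ - uₙ] → 0`, then `x` is in the domain and `a[uₙ - x] → 0` -/
  closed : ∀ (u : ℕ → domain) (x : H), Tendsto (fun n => (u n : H)) atTop (𝓝 x) →
    (∀ ε : ℝ, 0 < ε → ∃ N, ∀ m ≥ N, ∀ n ≥ N, (form (u m - u n) (u m - u n)).re < ε) →
    ∃ y : domain, (y : H) = x ∧
      Tendsto (fun n => (form (u n - y) (u n - y)).re) atTop (𝓝 0)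

/-- The closed subspace `χ_{(-∞,c)}(T) E`, for a bounded self-adjoint operator `T`: the spectral
projection `χ_{(-∞,c)}(T)` is the orthogonal projection onto the closure of the range of
`(c - T)₊ = f(T)`, where `f(s) = max (c - s) 0` is continuous and positive exactly on
`(-∞,c)`. -/
def spectralSubspaceIio {E : Type*} [NormedAddCommGroup E] [InnerProductSpace ℂ E]
    [CompleteSpace E] (T : E →L[ℂ] E) (c : ℝ) : Submodule ℂ E :=
  (LinearMap.range (cfc (fun s : ℝ => max (c - s) 0) T : E →L[ℂ] E).toLinearMap).topologicalClosure

/-- The closed subspace `χ_{(c,∞)}(T) E`, for a bounded self-adjoint operator `T`: the closure of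
the range of `(T - c)₊`. -/
def spectralSubspaceIoi {E : Type*} [NormedAddCommGroup E] [InnerProductSpace ℂ E]
    [CompleteSpace E] (T : E →L[ℂ] E) (c : ℝ) : Submodule ℂ E :=
  (LinearMap.range (cfc (fun s : ℝ => max (s - c) 0) T : E →L[ℂ] E).toLinearMap).topologicalClosure

/-- Dimension of a subspace, a natural number or `∞`. -/
def subspaceDim {E : Type*} [AddCommGroup E] [Module ℂ E] (V : Submodule ℂ E) : ℕ∞ :=
  Cardinal.toENat (Module.rank ℂ V)

section Operators

variable {H : Type*} [NormedAddCommGroup H] [InnerProductSpace ℂ H]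

/-- `ker (A - z)` for an unbounded operator `A` in `H`: the `u` in the domain with `A u = z u`. -/
def pmapEigenspace (A : H →ₗ.[ℂ] H) (z : ℂ) : Submodule ℂ H :=
  (LinearMap.ker (A.toFun - z • A.domain.subtype)).map A.domain.subtype

/-- The range of `A - z`. -/
def pmapShiftRange (A : H →ₗ.[ℂ] H) (z : ℂ) : Submodule ℂ H :=
  LinearMap.range (A.toFun - z • A.domain.subtype)

/-- The essential spectrum of a self-adjoint operator: the real `μ` such that `A - μ` is not a
Fredholm operator. -/
def essSpectrum (A : H →ₗ.[ℂ] H) : Set ℝ :=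
  {μ | ¬ (FiniteDimensional ℂ (pmapEigenspace A (μ : ℂ)) ∧
    IsClosed (pmapShiftRange A (μ : ℂ) : Set H) ∧
    FiniteDimensional ℂ (H ⧸ pmapShiftRange A (μ : ℂ)))}

/-- The bottom of the essential spectrum (`+∞` if the essential spectrum is empty). -/
def infEssSpectrum (A : H →ₗ.[ℂ] H) : EReal :=
  sInf ((fun μ : ℝ => (μ : EReal)) '' essSpectrum A)

variable [CompleteSpace H]

/-- The orthogonal projection in `H` onto `ker (A - z)`. (For a closed operator `A` this kernel is
closed, and the closure below is the kernel itself.) -/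
def eigenProjection (A : H →ₗ.[ℂ] H) (z : ℂ) : H →L[ℂ] H :=
  (pmapEigenspace A z).topologicalClosure.starProjection

/-- The closed subspace spanned by all common eigenvectors of `A` and `B`. -/
def commonEigenspan (A B : H →ₗ.[ℂ] H) : Submodule ℂ H :=
  (Submodule.span ℂ {u : H | u ≠ 0 ∧ (∃ z, u ∈ pmapEigenspace A z) ∧
    (∃ z, u ∈ pmapEigenspace B z)}).topologicalClosure

end Operators

namespace ClosedPosForm

variable {H : Type*} [NormedAddCommGroup H] [InnerProductSpace ℂ H] (a : ClosedPosForm H)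

/-- The form domain `H¹`, as a type carrying the inner product `a[·,·]`. -/
def Space : Type _ := a.domain

instance : AddCommGroup a.Space := inferInstanceAs (AddCommGroup a.domain)
instance : Module ℂ a.Space := inferInstanceAs (Module ℂ a.domain)

/-- The inner product `a[·,·]` on `H¹`. -/
@[reducible] def core : InnerProductSpace.Core ℂ a.Space where
  inner u v := a.form u v
  conj_inner_symm u v := a.conj_symm u v
  re_inner_nonneg u := by
    obtain ⟨c, hc, h⟩ := a.pos
    exact le_trans (by positivity) (h u)
  add_left u v w := by
    exact congrArg (fun l => l w) (map_add a.form u v)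
  smul_left u v r := by
    exact congrArg (fun l => l v) (map_smulₛₗ a.form r u)
  definite u hu := by
    obtain ⟨c, hc, h⟩ := a.pos
    have h1 := h u
    have h2 : a.form u u = 0 := hu
    rw [h2, Complex.zero_re] at h1
    have h3 : ‖(Subtype.val u : H)‖ ^ 2 ≤ 0 := by
      by_contra h4
      push Not at h4
      exact absurd h1 (not_le.mpr (mul_pos hc h4))
    have h4 : (Subtype.val u : H) = 0 := by
      have : ‖(Subtype.val u : H)‖ = 0 := by nlinarith [norm_nonneg (Subtype.val u : H)]
      simpa using this
    exact Subtype.ext h4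

instance : NormedAddCommGroup a.Space := a.core.toNormedAddCommGroup
instance : InnerProductSpace ℂ a.Space := InnerProductSpace.ofCore a.core.toCore

theorem inner_eq (u v : a.Space) : inner ℂ u v = a.form u v := rfl

theorem norm_sq_eq (u : a.Space) : ‖u‖ ^ 2 = (a.form u u).re := by
  rw [← a.inner_eq]; exact norm_sq_eq_re_inner (𝕜 := ℂ) u

/-- The embedding of `H¹` into `H`, as a linear map. -/
def embedₗ : a.Space →ₗ[ℂ] H := a.domain.subtype

theorem exists_norm_embedₗ_le : ∃ C : ℝ, ∀ u, ‖a.embedₗ u‖ ≤ C * ‖u‖ := by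
  obtain ⟨c, hc, h⟩ := a.pos
  refine ⟨(Real.sqrt c)⁻¹, fun u => ?_⟩
  have h1 : c * ‖a.embedₗ u‖ ^ 2 ≤ ‖u‖ ^ 2 := by rw [a.norm_sq_eq]; exact h u
  have hs : 0 < Real.sqrt c := Real.sqrt_pos.mpr hc
  rw [← div_eq_inv_mul, le_div_iff₀ hs]
  refine le_of_sq_le_sq ?_ (norm_nonneg _)
  rw [mul_pow, Real.sq_sqrt hc.le]
  linarith

/-- The continuous embedding of `H¹` into `H`. -/
def embed : a.Space →L[ℂ] H :=
  a.embedₗ.mkContinuousOfExistsBound a.exists_norm_embedₗ_le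

theorem embed_apply (u : a.Space) : a.embed u = (Subtype.val u : H) := rfl

instance [CompleteSpace H] : CompleteSpace a.Space := by
  refine Metric.complete_of_cauchySeq_tendsto fun u hu => ?_
  have hJ : CauchySeq fun n => a.embed (u n) := a.embed.uniformContinuous.comp_cauchySeq hu
  obtain ⟨x, hx⟩ := cauchySeq_tendsto_of_complete hJ
  obtain ⟨y, -, hy⟩ := a.closed u x hx (fun ε hε => by
    obtain ⟨N, hN⟩ := Metric.cauchySeq_iff.mp hu (Real.sqrt ε) (Real.sqrt_pos.mpr hε)
    refine ⟨N, fun m hm n hn => ?_⟩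
    have h := hN m hm n hn
    rw [dist_eq_norm] at h
    have h2 : ‖u m - u n‖ ^ 2 < ε := by
      have := Real.sq_sqrt hε.le
      nlinarith [norm_nonneg (u m - u n)]
    rw [a.norm_sq_eq] at h2
    exact h2)
  refine ⟨(show a.Space from y), tendsto_iff_norm_sub_tendsto_zero.mpr ?_⟩
  have h1 : Tendsto (fun n => ‖u n - (show a.Space from y)‖ ^ 2) atTop (𝓝 0) := by
    refine hy.congr fun n => ?_
    rw [a.norm_sq_eq]; rfl
  have h2 := h1.sqrt
  simpa [Real.sqrt_sq (norm_nonneg _)] using h2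

/-- The restriction of the form `a` to an `H¹`-closed subspace `V` of `H¹` that is dense
in `H`. -/
def restrict (V : Submodule ℂ a.Space) (hV : IsClosed (V : Set a.Space))
    (hd : Dense (a.embed '' (V : Set a.Space))) : ClosedPosForm H :=
  have hle : V.map a.embedₗ ≤ a.domain := by
    rintro _ ⟨u, -, rfl⟩
    exact Subtype.property u
  { domain := V.map a.embedₗ
    dense_domain := hd
    form := LinearMap.mk₂'ₛₗ (starRingEnd ℂ) (RingHom.id ℂ)
      (fun u v => a.form (Submodule.inclusion hle u) (Submodule.inclusion hle v))
      (fun u v w => by simp only [map_add, LinearMap.add_apply])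
      (fun c u v => by simp only [map_smul, map_smulₛₗ, LinearMap.smul_apply])
      (fun u v w => by simp only [map_add])
      (fun c u v => by simp only [map_smul, RingHom.id_apply])
    conj_symm := fun u v => a.conj_symm _ _
    pos := by
      obtain ⟨c, hc, h⟩ := a.pos
      exact ⟨c, hc, fun u => h (Submodule.inclusion hle u)⟩
    closed := by
      intro u x hu hc
      obtain ⟨y, hyx, hy⟩ := a.closed (fun n => Submodule.inclusion hle (u n)) x hu hc
      have hmem : ∀ n, (show a.Space from Submodule.inclusion hle (u n)) ∈ V := by
        intro n
        obtain ⟨w, hw, hwu⟩ := (u n).2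
        have : w = (show a.Space from Submodule.inclusion hle (u n)) := Subtype.ext hwu
        exact this ▸ hw
      have hlim : Tendsto (fun n => (show a.Space from Submodule.inclusion hle (u n))) atTop
          (𝓝 (show a.Space from y)) := by
        rw [tendsto_iff_norm_sub_tendsto_zero]
        have h1 : Tendsto (fun n => ‖(show a.Space from Submodule.inclusion hle (u n)) -
            (show a.Space from y)‖ ^ 2) atTop (𝓝 0) := by
          refine hy.congr fun n => ?_
          rw [a.norm_sq_eq]; rfl
        have h2 := h1.sqrt
        simpa [Real.sqrt_sq (norm_nonneg _)] using h2
      have hyV : (show a.Space from y) ∈ V :=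
        hV.mem_of_tendsto hlim (Eventually.of_forall hmem)
      exact ⟨⟨x, ⟨y, hyV, hyx⟩⟩, rfl, by
        subst hyx
        exact hy⟩ }

/-- The operator `A_a` in `H` generated by the form `a`: `x ∈ D(A_a)` and `A_a x = f` iff
`x ∈ H¹` and `a[x,v] = (f,v)` for all `v ∈ H¹`. -/
def operator : H →ₗ.[ℂ] H :=
  Submodule.toLinearPMap
    { carrier := {p : H × H | ∃ u : a.Space, a.embed u = p.1 ∧
        ∀ v : a.Space, inner ℂ u v = inner ℂ p.2 (a.embed v)}
      zero_mem' := ⟨0, by simp, by simp⟩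
      add_mem' := by
        rintro p q ⟨u, hu, hu'⟩ ⟨w, hw, hw'⟩
        exact ⟨u + w, by simp [hu, hw], fun v => by simp [hu', hw']⟩
      smul_mem' := by
        rintro c p ⟨u, hu, hu'⟩
        exact ⟨c • u, by simp [hu], fun v => by simp [hu']⟩ }

theorem eq_zero_of_dense {V : Submodule ℂ a.Space} (hd : Dense (a.embed '' (V : Set a.Space)))
    {f : H} (hf : ∀ v ∈ V, inner ℂ f (a.embed v) = 0) : f = 0 := by
  refine hd.eq_zero_of_inner_left (𝕜 := ℂ) ?_
  rintro _ ⟨w, hw, rfl⟩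
  exact hf w hw

theorem mem_graph_operator {x f : H} : (x, f) ∈ a.operator.graph ↔
    ∃ u : a.Space, a.embed u = x ∧ ∀ v : a.Space, inner ℂ u v = inner ℂ f (a.embed v) := by
  rw [operator, Submodule.toLinearPMap_graph_eq]
  · rfl
  · rintro ⟨x, f⟩ ⟨u, hu, hu'⟩ (rfl : x = 0)
    have hu0 : u = 0 := Subtype.ext hu
    refine a.eq_zero_of_dense (V := ⊤) ?_ (fun v _ => by rw [← hu', hu0, inner_zero_left])
    refine a.dense_domain.mono ?_
    exact fun y hy => ⟨⟨y, hy⟩, trivial, rfl⟩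

section Complete

variable [CompleteSpace H]

/-- The bounded everywhere defined inverse `A_a⁻¹ : H → H¹`: it is characterised by
`a[A_a⁻¹ f, v] = (f, v)` for all `v ∈ H¹`, i.e. it is the adjoint of the embedding. -/
def invToSpace : H →L[ℂ] a.Space := ContinuousLinearMap.adjoint a.embed

/-- The inverse `A_a⁻¹` as a bounded operator in `H`. -/
def inv : H →L[ℂ] H := a.embed.comp a.invToSpace

/-- The inverse `A_a⁻¹` as a bounded operator in `H¹`. -/
def invOnSpace : a.Space →L[ℂ] a.Space := a.invToSpace.comp a.embed

/-- `inv` is indeed the inverse of the operator generated by the form. -/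
theorem mem_graph_operator_iff_inv {x f : H} : (x, f) ∈ a.operator.graph ↔ a.inv f = x := by
  rw [a.mem_graph_operator]
  constructor
  · rintro ⟨u, rfl, hu⟩
    have : a.invToSpace f = u := ext_inner_right ℂ fun v => by
      rw [invToSpace, ContinuousLinearMap.adjoint_inner_left, hu]
    rw [← this]; rfl
  · rintro rfl
    exact ⟨a.invToSpace f, rfl, fun v => by
      rw [invToSpace, ContinuousLinearMap.adjoint_inner_left]⟩

/-- The spectral subspace `χ_{(-∞,lam)}(A_a) H`. As `A_a` is bounded below by a positive constant,
`t ∈ σ(A_a)` satisfies `t < lam` iff `lam > 0` and `s = 1 / t` satisfies `s > 1 / lam`, so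
that `χ_{(-∞,lam)}(A_a)` is `χ_{(1/lam,∞)}(A_a⁻¹)` for `lam > 0`, and `0` for `lam ≤ 0`. -/
def spectralSubspaceBelow (lam : ℝ) : Submodule ℂ H :=
  if 0 < lam then spectralSubspaceIoi a.inv lam⁻¹ else ⊥

/-- The counting function `N(lam) = dim χ_{(-∞,lam)}(A_a) H`. -/
def counting (lam : ℝ) : ℕ∞ := subspaceDim (a.spectralSubspaceBelow lam)

end Complete

/-- The operator `A` from `H¹` to `H`: its domain `H_A¹` consists of the `u ∈ H¹` for
which `v ↦ a[u,v]` is an `H`-continuous functional on `H₀¹`, i.e. (by the Riesz representation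
theorem) is given by some `f ∈ H`, and `A u = f` iff `a[u,v] = (f,v)` for all `v ∈ H₀¹`. -/
def maxOperator (H01 : Submodule ℂ a.Space) : a.Space →ₗ.[ℂ] H :=
  Submodule.toLinearPMap
    { carrier := {p : a.Space × H | ∀ v ∈ H01, inner ℂ p.1 v = inner ℂ p.2 (a.embed v)}
      zero_mem' := by simp
      add_mem' := by
        intro p q hp hq v hv
        simp [hp v hv, hq v hv]
      smul_mem' := by
        intro c p hp v hv
        simp [hp v hv] }

theorem mem_graph_maxOperator {H01 : Submodule ℂ a.Space}
    (hd : Dense (a.embed '' (H01 : Set a.Space))) {u : a.Space} {f : H} :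
    (u, f) ∈ (a.maxOperator H01).graph ↔ ∀ v ∈ H01, inner ℂ u v = inner ℂ f (a.embed v) := by
  rw [maxOperator, Submodule.toLinearPMap_graph_eq]
  · rfl
  · rintro ⟨u, f⟩ hu (rfl : u = 0)
    refine a.eq_zero_of_dense hd (fun v hv => ?_)
    rw [← hu v hv, inner_zero_left]

/-- `G_z = {u ∈ H_A¹ : A u = z u}`. -/
def G (H01 : Submodule ℂ a.Space) (z : ℂ) : Submodule ℂ a.Space :=
  (LinearMap.ker ((a.maxOperator H01).toFun -
    z • (a.embed.toLinearMap.comp (a.maxOperator H01).domain.subtype))).map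
      (a.maxOperator H01).domain.subtype

theorem mem_G {H01 : Submodule ℂ a.Space} (hd : Dense (a.embed '' (H01 : Set a.Space)))
    {z : ℂ} {u : a.Space} :
    u ∈ a.G H01 z ↔ ∀ v ∈ H01, inner ℂ u v = inner ℂ (z • a.embed u) (a.embed v) := by
  rw [← a.mem_graph_maxOperator hd, LinearPMap.mem_graph_iff]
  constructor
  · rintro ⟨w, hw, rfl⟩
    exact ⟨w, rfl, sub_eq_zero.mp hw⟩
  · rintro ⟨w, hw, hw'⟩
    subst hw
    exact ⟨w, sub_eq_zero.mpr hw', rfl⟩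

theorem isClosed_G {H01 : Submodule ℂ a.Space} (hd : Dense (a.embed '' (H01 : Set a.Space)))
    (z : ℂ) : IsClosed (a.G H01 z : Set a.Space) := by
  have : (a.G H01 z : Set a.Space) =
      ⋂ v ∈ H01, {u | inner ℂ u v = inner ℂ (z • a.embed u) (a.embed v)} := by
    ext u
    simp [a.mem_G hd]
  rw [this]
  refine isClosed_biInter fun v _ => isClosed_eq ?_ ?_ <;> fun_prop

end ClosedPosForm

/-- The abstract setting: a closed positive form `a` with domain `H¹`, dense in `H`, and a closed
subspace `H₀¹` of the Hilbert space `(H¹, a[·,·])` which is dense in `H`. -/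
structure FormPair (H : Type*) [NormedAddCommGroup H] [InnerProductSpace ℂ H] where
  /-- the form on `H¹` -/
  a : ClosedPosForm H
  /-- the subspace `H₀¹` -/
  H01 : Submodule ℂ a.Space
  isClosed_H01 : IsClosed (H01 : Set a.Space)
  dense_H01 : Dense (a.embed '' (H01 : Set a.Space))

namespace FormPair

variable {H : Type*} [NormedAddCommGroup H] [InnerProductSpace ℂ H] (P : FormPair H)

/-- The restriction of the form to `H₀¹`. -/
def a₀ : ClosedPosForm H := P.a.restrict P.H01 P.isClosed_H01 P.dense_H01

/-- The Neumann operator. -/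
def AN : H →ₗ.[ℂ] H := P.a.operator

/-- The Dirichlet operator. -/
def AD : H →ₗ.[ℂ] H := P.a₀.operator

/-- `G_lam = ker (A - lam)`, a closed subspace of `H¹`. -/
def G (lam : ℝ) : Submodule ℂ P.a.Space := P.a.G P.H01 (lam : ℂ)

variable [CompleteSpace H]

instance (lam : ℝ) : CompleteSpace (P.G lam) :=
  (P.a.isClosed_G P.dense_H01 (lam : ℂ)).completeSpace_coe

/-- The Neumann counting function. -/
def NN (lam : ℝ) : ℕ∞ := P.a.counting lam

/-- The Dirichlet counting function. -/
def ND (lam : ℝ) : ℕ∞ := P.a₀.counting lam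

/-- `n_D(lam)`, the dimension of `E_D(lam) 𝓗`, where `𝓗` is the orthogonal complement of the span
of the common eigenvectors of the two operators. -/
def nD (lam : ℝ) : ℕ∞ :=
  subspaceDim ((commonEigenspan P.AN P.AD)ᗮ.map (eigenProjection P.AD (lam : ℂ)).toLinearMap)

/-- The abstract Dirichlet-to-Neumann operator `𝓑_lam = (I - lam Π'_lam A_N⁻¹)|_{G_lam}` in the
Hilbert space `G_lam` with the inner product `a[·,·]`, where `Π'_lam` is the `H¹`-orthogonal
projection onto `G_lam`. -/
def B (lam : ℝ) : P.G lam →L[ℂ] P.G lam :=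
  ContinuousLinearMap.id ℂ (P.G lam) -
    (lam : ℂ) • ((P.G lam).orthogonalProjectionOnto.comp
      (P.a.invOnSpace.comp (P.G lam).subtypeL))

/-- `G_lam⁻ = χ_{(-∞,0)}(𝓑_lam) G_lam`. -/
def Gneg (lam : ℝ) : Submodule ℂ (P.G lam) := spectralSubspaceIio (P.B lam) 0

end FormPair

end

/-! All four terms are indices of one Hermitian form, `a[u,v] - lam (u,v)` on `H¹`, which is the
form of `M = 1 - lam A_N⁻¹`. By Glazman's lemma (`isGreatest_counting`) `N_N` is the largest
dimension of a subspace where this form is negative, and `N_D` is the same for `V = H₀¹`. The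
operator `𝓑_lam` is the compression of `M` to `G = G_lam`, so `dim G⁻` is the index on `G`. By
definition `G` is the orthogonal complement of `V` for the form, and `V ⊓ G` is `ker (A_D - lam)`.
Splitting off the common eigenvectors, which lie in `ker M`, leaves a complement `Z` of dimension
`n_D`.

The theorem is thus the algebraic identity `isGreatest_posDims_add`: index on `H¹` = index on `V` +
`dim Z` + index on `G`. For `≥`, take maximal negative subspaces of `V` and `G` and add `Z`. The
form is nonpositive on the sum, and the sum meets `ker M` only in `0`, so a small step along `-M`
makes it negative. For `≤`, cut a negative subspace by orthogonality to `Z` and to the maximal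
negative subspace of `V`. What remains lies in `V ⊔ G`, and its `V`-components contribute nothing
negative, so it maps injectively to a negative subspace of `G`.

The bound on `lam` makes `A_D - lam` Fredholm. Its closed range yields the solvability statement
`mem_sup_of_isClosed_range`, and its finite-dimensional kernel allows the splitting of `V ⊓ G`. -/

/-! ### Dimensions of subspaces with values in `ℕ∞`. -/

section Dimension

universe u

variable {E E' : Type u} [AddCommGroup E] [Module ℂ E] [AddCommGroup E'] [Module ℂ E']

theorem subspaceDim_mono {F F' : Submodule ℂ E} (h : F ≤ F') : subspaceDim F ≤ subspaceDim F' :=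
  OrderHomClass.mono Cardinal.toENat (Submodule.rank_mono h)

theorem subspaceDim_le_of_injective {F : Submodule ℂ E} {F' : Submodule ℂ E'} (f : F →ₗ[ℂ] F')
    (hf : Function.Injective f) : subspaceDim F ≤ subspaceDim F' :=
  OrderHomClass.mono Cardinal.toENat (LinearMap.rank_le_of_injective f hf)

theorem subspaceDim_le_of_ker {F : Submodule ℂ E} {F' : Submodule ℂ E'} (f : E →ₗ[ℂ] E')
    (hF : ∀ x ∈ F, f x ∈ F') (hf : ∀ x ∈ F, f x = 0 → x = 0) :
    subspaceDim F ≤ subspaceDim F' := by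
  refine subspaceDim_le_of_injective (f.restrict hF) ?_
  rw [injective_iff_map_eq_zero]
  intro x hx
  exact Subtype.ext (hf x x.2 (congrArg Subtype.val hx))

theorem subspaceDim_map {F : Submodule ℂ E} (f : E →ₗ[ℂ] E')
    (hf : ∀ x ∈ F, f x = 0 → x = 0) : subspaceDim (F.map f) = subspaceDim F := by
  refine le_antisymm (OrderHomClass.mono Cardinal.toENat (rank_map_le f F))
    (subspaceDim_le_of_ker f (fun x hx => Submodule.mem_map_of_mem hx) hf)

theorem subspaceDim_sup_le (F F' : Submodule ℂ E) :
    subspaceDim (F ⊔ F') ≤ subspaceDim F + subspaceDim F' := by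
  rw [subspaceDim, subspaceDim, subspaceDim, ← map_add]
  exact OrderHomClass.mono Cardinal.toENat (Submodule.rank_add_le_rank_add_rank F F')

theorem subspaceDim_sup_of_disjoint {F F' : Submodule ℂ E} (h : Disjoint F F') :
    subspaceDim (F ⊔ F') = subspaceDim F + subspaceDim F' := by
  rw [subspaceDim, subspaceDim, subspaceDim, ← map_add, ← Submodule.rank_sup_add_rank_inf_eq,
    h.eq_bot, rank_bot, add_zero]

theorem subspaceDim_bot : subspaceDim (⊥ : Submodule ℂ E) = 0 := by
  rw [subspaceDim, rank_bot, map_zero]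

theorem subspaceDim_lt_top_iff {F : Submodule ℂ E} :
    subspaceDim F < ⊤ ↔ FiniteDimensional ℂ F := by
  rw [subspaceDim, Cardinal.toENat_lt_top]
  exact Module.rank_lt_aleph0_iff

theorem subspaceDim_le_ker_add {F : Submodule ℂ E} {F' : Submodule ℂ E'} (f : E →ₗ[ℂ] E')
    (hF : ∀ x ∈ F, f x ∈ F') :
    subspaceDim F ≤ subspaceDim (F ⊓ LinearMap.ker f) + subspaceDim F' := by
  have h := LinearMap.rank_range_add_rank_ker (f.restrict hF)
  have h1 : Module.rank ℂ (LinearMap.range (f.restrict hF)) ≤ Module.rank ℂ F' :=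
    Submodule.rank_le _
  have h2 : Cardinal.toENat (Module.rank ℂ (LinearMap.ker (f.restrict hF))) ≤
      subspaceDim (F ⊓ LinearMap.ker f) := by
    refine subspaceDim_le_of_ker F.subtype (fun x hx => ⟨x.2, ?_⟩) fun x _ hx => Subtype.ext hx
    exact congrArg Subtype.val hx
  rw [subspaceDim, ← h, map_add, add_comm]
  exact add_le_add h2 (OrderHomClass.mono Cardinal.toENat h1)

end Dimension

/-- Finite-dimensional subspaces are closed, and `ℕ∞` does not distinguish infinite cardinals. The
closures in the spectral subspaces therefore do not affect dimensions. -/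
theorem subspaceDim_topologicalClosure {E : Type*} [NormedAddCommGroup E]
    [InnerProductSpace ℂ E] (F : Submodule ℂ E) :
    subspaceDim F.topologicalClosure = subspaceDim F := by
  by_cases h : FiniteDimensional ℂ F
  · rw [(Submodule.closed_of_finiteDimensional F).submodule_topologicalClosure_eq]
  · have h1 : subspaceDim F = ⊤ := by
      rw [← subspaceDim_lt_top_iff, not_lt_top_iff] at h
      exact h
    exact le_antisymm (h1 ▸ le_top) (subspaceDim_mono F.le_topologicalClosure)

/-! ### Subspaces on which a function is positive. -/

section Definite

universe u

variable {E E' : Type u} [AddCommGroup E] [Module ℂ E] [AddCommGroup E'] [Module ℂ E']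

/-- `φ` is positive on the nonzero vectors of `F`. -/
def PosOn (φ : E → ℝ) (F : Submodule ℂ E) : Prop := ∀ x ∈ F, x ≠ 0 → 0 < φ x

/-- The dimensions of the subspaces on which `φ` is positive. -/
def posDims (φ : E → ℝ) : Set ℕ∞ := {n | ∃ F, PosOn φ F ∧ subspaceDim F = n}

theorem PosOn.map {φ : E → ℝ} {ψ : E' → ℝ} {F : Submodule ℂ E} (hF : PosOn φ F)
    (f : E →ₗ[ℂ] E') (h : ∀ x ∈ F, 0 < φ x → 0 < ψ (f x)) : PosOn ψ (F.map f) := by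
  rintro _ ⟨x, hx, rfl⟩ h0
  exact h x hx (hF x hx fun h1 => h0 (by rw [h1, map_zero]))

theorem PosOn.subspaceDim_map {φ : E → ℝ} {ψ : E' → ℝ} {F : Submodule ℂ E} (hF : PosOn φ F)
    (f : E →ₗ[ℂ] E') (h : ∀ x ∈ F, 0 < φ x → 0 < ψ (f x)) (hψ : ψ 0 = 0) :
    subspaceDim (F.map f) = subspaceDim F := by
  refine _root_.subspaceDim_map f fun x hx hfx => ?_
  by_contra h0
  have := h x hx (hF x hx h0)
  rw [hfx, hψ] at this
  exact lt_irrefl _ this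

/-- Since `ψ 0 = 0`, a map that preserves positivity cannot kill a positive vector, so it is
injective on positive subspaces. -/
theorem posDims_subset {φ : E → ℝ} {ψ : E' → ℝ} (f : E →ₗ[ℂ] E')
    (h : ∀ x, 0 < φ x → 0 < ψ (f x)) (hψ : ψ 0 = 0) : posDims φ ⊆ posDims ψ := by
  rintro n ⟨F, hF, rfl⟩
  exact ⟨F.map f, hF.map f fun x _ => h x, hF.subspaceDim_map f (fun x _ => h x) hψ⟩

theorem isGreatest_posDims_of_nonpos {φ : E → ℝ} (h : ∀ x, φ x ≤ 0) :
    IsGreatest (posDims φ) 0 := by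
  refine ⟨⟨⊥, fun x hx h0 => absurd hx h0, subspaceDim_bot⟩, ?_⟩
  rintro n ⟨F, hF, rfl⟩
  have : F = ⊥ := (Submodule.eq_bot_iff _).2 fun x hx => by
    by_contra h0
    exact absurd (hF x hx h0) (not_lt.2 (h x))
  rw [this, subspaceDim_bot]

end Definite

/-! ### Spectral subspaces as maximal definite subspaces. -/

section Spectral

variable {E : Type*} [NormedAddCommGroup E] [InnerProductSpace ℂ E] [CompleteSpace E]

/-- Writing `P = b* b` turns `(P x, x)` into `‖b x‖²`. -/
theorem apply_eq_zero_of_nonneg_of_re_inner_eq_zero {P : E →L[ℂ] E} (hP : 0 ≤ P) {x : E}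
    (hx : (inner ℂ (P x) x).re = 0) : P x = 0 := by
  obtain ⟨b, hb⟩ := CStarAlgebra.nonneg_iff_eq_star_mul_self.mp hP
  have h1 : P x = ContinuousLinearMap.adjoint b (b x) := by rw [hb]; rfl
  have h2 : b x = 0 := by
    rw [h1, ContinuousLinearMap.adjoint_inner_left] at hx
    have h3 : ‖b x‖ ^ 2 = 0 := by rw [norm_sq_eq_re_inner (𝕜 := ℂ)]; exact hx
    simpa using h3
  rw [h1, h2, map_zero]

/-- If `P, N ≥ 0` and `N P = 0`, then the range of `P` is a subspace of maximal dimension on which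
the quadratic form of `P - N` is positive. -/
theorem isGreatest_posDims_sub {P N : E →L[ℂ] E} (hP : 0 ≤ P) (hN : 0 ≤ N) (hNP : N * P = 0) :
    IsGreatest (posDims fun x => (inner ℂ ((P - N) x) x).re)
      (subspaceDim (LinearMap.range P.toLinearMap).topologicalClosure) := by
  have hP' := (ContinuousLinearMap.nonneg_iff_isPositive P).1 hP
  have hN' := (ContinuousLinearMap.nonneg_iff_isPositive N).1 hN
  rw [subspaceDim_topologicalClosure]
  constructor
  · refine ⟨_, ?_, rfl⟩
    rintro _ ⟨z, rfl⟩ h0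
    have h1 : N (P z) = 0 := congrArg (fun T : E →L[ℂ] E => T z) hNP
    have h2 : (P - N) (P z) = P (P z) := by simp [h1]
    change 0 < (inner ℂ ((P - N) (P z)) (P z)).re
    rw [h2]
    refine lt_of_le_of_ne (hP'.re_inner_nonneg_left (P z)) fun h3 => h0 ?_
    have h4 := apply_eq_zero_of_nonneg_of_re_inner_eq_zero hP h3.symm
    have h5 := hP'.inner_left_eq_inner_right (P z) z
    rw [h4, inner_zero_left] at h5
    exact inner_self_eq_zero.1 h5.symm
  · rintro n ⟨F, hF, rfl⟩
    -- `P` is injective on a positive subspace: where `P x = 0` the form equals `-(N x, x) ≤ 0`.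
    refine subspaceDim_le_of_ker P.toLinearMap (fun x _ => ⟨x, rfl⟩) fun x hx h0 => ?_
    by_contra h1
    have h2 := hF x hx h1
    have h3 : P x = 0 := h0
    have h4 : 0 ≤ (inner ℂ (N x) x).re := hN'.re_inner_nonneg_left x
    simp only [_root_.sub_apply, h3, zero_sub, inner_neg_left, Complex.neg_re] at h2
    linarith

theorem cfc_max_mul_cfc_max (T : E →L[ℂ] E) (c : ℝ) :
    cfc (fun s : ℝ => max (c - s) 0) T * cfc (fun s : ℝ => max (s - c) 0) T = 0 := by
  rw [← cfc_mul _ _ T (by fun_prop) (by fun_prop)]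
  have : (fun s : ℝ => max (c - s) 0 * max (s - c) 0) = fun _ => 0 := by
    funext s
    rcases le_total s c with h | h
    · rw [max_eq_right (sub_nonpos.2 h), mul_zero]
    · rw [max_eq_right (sub_nonpos.2 h), zero_mul]
  rw [this]
  exact cfc_const_zero ℝ T

theorem cfc_max_sub_cfc_max {T : E →L[ℂ] E} (hT : IsSelfAdjoint T) (c : ℝ) :
    cfc (fun s : ℝ => max (s - c) 0) T - cfc (fun s : ℝ => max (c - s) 0) T =
      T - algebraMap ℝ (E →L[ℂ] E) c := by
  rw [← cfc_sub _ _ T (by fun_prop) (by fun_prop)]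
  have : (fun s : ℝ => max (s - c) 0 - max (c - s) 0) = fun s => s - c := by
    funext s
    rcases le_total s c with h | h
    · rw [max_eq_right (sub_nonpos.2 h), max_eq_left (sub_nonneg.2 h)]; ring
    · rw [max_eq_right (sub_nonpos.2 h), max_eq_left (sub_nonneg.2 h)]; ring
  rw [this, cfc_sub _ _ T (by fun_prop) (by fun_prop), cfc_id' ℝ T, cfc_const c T]

/-- The positive and negative parts of `T - c` are nonnegative operators with product zero and
difference `T - c`. -/
theorem isGreatest_posDims_spectralSubspaceIoi {T : E →L[ℂ] E} (hT : IsSelfAdjoint T) (c : ℝ) :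
    IsGreatest (posDims fun x => (inner ℂ (T x) x).re - c * ‖x‖ ^ 2)
      (subspaceDim (spectralSubspaceIoi T c)) := by
  have h := isGreatest_posDims_sub (P := cfc (fun s : ℝ => max (s - c) 0) T)
    (N := cfc (fun s : ℝ => max (c - s) 0) T)
    (cfc_nonneg fun x _ => le_max_right _ _) (cfc_nonneg fun x _ => le_max_right _ _)
    (cfc_max_mul_cfc_max T c)
  rw [cfc_max_sub_cfc_max hT] at h
  have key : (fun x : E => (inner ℂ (T x) x).re - c * ‖x‖ ^ 2) =
      fun x => (inner ℂ ((T - algebraMap ℝ (E →L[ℂ] E) c) x) x).re := by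
    funext x
    have hx : algebraMap ℝ (E →L[ℂ] E) c x = (c : ℂ) • x := by
      simp [ContinuousLinearMap.algebraMap_apply]
    rw [norm_sq_eq_re_inner (𝕜 := ℂ) x, _root_.sub_apply, inner_sub_left, hx, inner_smul_left]
    simp
  rw [key]
  exact h

theorem isGreatest_posDims_spectralSubspaceIio {T : E →L[ℂ] E} (hT : IsSelfAdjoint T) (c : ℝ) :
    IsGreatest (posDims fun x => c * ‖x‖ ^ 2 - (inner ℂ (T x) x).re)
      (subspaceDim (spectralSubspaceIio T c)) := by
  have hc : cfc (fun s : ℝ => max (s - c) 0) T * cfc (fun s : ℝ => max (c - s) 0) T = 0 := by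
    rw [(cfc_commute_cfc _ _ T).eq, cfc_max_mul_cfc_max]
  have h := isGreatest_posDims_sub (P := cfc (fun s : ℝ => max (c - s) 0) T)
    (N := cfc (fun s : ℝ => max (s - c) 0) T)
    (cfc_nonneg fun x _ => le_max_right _ _) (cfc_nonneg fun x _ => le_max_right _ _) hc
  rw [← neg_sub, cfc_max_sub_cfc_max hT, neg_sub] at h
  have key : (fun x : E => c * ‖x‖ ^ 2 - (inner ℂ (T x) x).re) =
      fun x => (inner ℂ ((algebraMap ℝ (E →L[ℂ] E) c - T) x) x).re := by
    funext x
    have hx : algebraMap ℝ (E →L[ℂ] E) c x = (c : ℂ) • x := by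
      simp [ContinuousLinearMap.algebraMap_apply]
    rw [norm_sq_eq_re_inner (𝕜 := ℂ) x, _root_.sub_apply, inner_sub_left, hx, inner_smul_left]
    simp
  rw [key]
  exact h

end Spectral

/-! ### Passing between `J* J` and `J J*`. -/

section Adjoint

universe u

variable {E F : Type u} [NormedAddCommGroup E] [InnerProductSpace ℂ E] [CompleteSpace E]
  [NormedAddCommGroup F] [InnerProductSpace ℂ F] [CompleteSpace F]

/-- Cauchy–Schwarz gives `‖J u‖² = (J* J u, u) ≤ ‖J* J u‖ ‖u‖`; square, insert the hypothesis and
cancel `‖J u‖²`. -/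
theorem norm_sq_lt_of_adjoint (J : E →L[ℂ] F) {c : ℝ} {u : E} (hu : ‖u‖ ^ 2 < c * ‖J u‖ ^ 2) :
    ‖J u‖ ^ 2 < c * ‖ContinuousLinearMap.adjoint J (J u)‖ ^ 2 := by
  set w := ContinuousLinearMap.adjoint J (J u)
  have h1 : ‖J u‖ ^ 2 ≤ ‖w‖ * ‖u‖ := by
    rw [norm_sq_eq_re_inner (𝕜 := ℂ), ← ContinuousLinearMap.adjoint_inner_left]
    exact (Complex.re_le_norm _).trans (norm_inner_le_norm _ _)
  have hJ : 0 < ‖J u‖ ^ 2 := by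
    refine lt_of_le_of_ne (by positivity) fun h => ?_
    rw [← h, mul_zero] at hu
    exact absurd hu (not_lt.2 (by positivity))
  have hc : 0 < c := by
    by_contra hc
    have := mul_nonneg (neg_nonneg.2 (not_lt.1 hc)) hJ.le
    nlinarith [sq_nonneg ‖u‖]
  have hw : 0 < ‖w‖ := by
    by_contra hw
    nlinarith [norm_nonneg u]
  have h2 : (‖J u‖ ^ 2) ^ 2 ≤ (‖w‖ * ‖u‖) ^ 2 := pow_le_pow_left₀ hJ.le h1 2
  have h3 : (‖w‖ * ‖u‖) ^ 2 < ‖w‖ ^ 2 * (c * ‖J u‖ ^ 2) := by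
    rw [mul_pow]
    exact mul_lt_mul_of_pos_left hu (by positivity)
  have h4 : ‖J u‖ ^ 2 * ‖J u‖ ^ 2 < c * ‖w‖ ^ 2 * ‖J u‖ ^ 2 := by nlinarith
  exact lt_of_mul_lt_mul_right h4 hJ.le

/-- With `J` the embedding of `H¹` in `H`, this transfers the index from the form on `H¹` to the
bounded inverse `J J*` on `H`, where the spectral projection is defined. -/
theorem posDims_adjoint (J : E →L[ℂ] F) (c : ℝ) :
    posDims (fun u : E => c * ‖J u‖ ^ 2 - ‖u‖ ^ 2) =
      posDims (fun y : F => c * ‖ContinuousLinearMap.adjoint J y‖ ^ 2 - ‖y‖ ^ 2) := by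
  refine Set.Subset.antisymm (posDims_subset J.toLinearMap (fun u hu => ?_) (by simp))
    (posDims_subset (ContinuousLinearMap.adjoint J).toLinearMap (fun u hu => ?_) (by simp))
  · exact sub_pos.2 (norm_sq_lt_of_adjoint J (sub_pos.1 hu))
  · have := norm_sq_lt_of_adjoint (ContinuousLinearMap.adjoint J) (sub_pos.1 hu)
    rw [ContinuousLinearMap.adjoint_adjoint] at this
    exact sub_pos.2 this

theorem posDims_mul_left {E : Type*} [AddCommGroup E] [Module ℂ E] {c : ℝ} (hc : 0 < c)
    (φ : E → ℝ) : posDims (fun x => c * φ x) = posDims φ := by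
  simp only [posDims, PosOn, mul_pos_iff_of_pos_left hc]

/-- If `1 - c J J*` has closed range, then the vectors orthogonal to the kernel of `1 - c J* J`
are in its range. -/
theorem exists_eq_of_isClosed_range (J : E →L[ℂ] F) (c : ℝ)
    (hcl : IsClosed (LinearMap.range (LinearMap.id - (c : ℂ) •
      (J ∘L ContinuousLinearMap.adjoint J).toLinearMap) : Set F)) {w : E}
    (hw : ∀ z : E, z = (c : ℂ) • ContinuousLinearMap.adjoint J (J z) → inner ℂ w z = 0) :
    ∃ p : E, p - (c : ℂ) • ContinuousLinearMap.adjoint J (J p) = w := by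
  set S := LinearMap.range (LinearMap.id - (c : ℂ) •
      (J ∘L ContinuousLinearMap.adjoint J).toLinearMap) with hS
  -- `S` is closed, so it suffices to test against `y ⊥ S`. Such `y` satisfies `y = c J J* y`, hence
  -- `J* y` is a solution to which `w` is orthogonal by `hw`.
  have hmem : J w ∈ S := by
    have := hcl.completeSpace_coe
    rw [← Submodule.orthogonal_orthogonal S, Submodule.mem_orthogonal]
    intro y hy
    have hy0 : y - (c : ℂ) • J (ContinuousLinearMap.adjoint J y) = 0 := by
      refine ext_inner_left ℂ fun v => ?_
      have h1 := (Submodule.mem_orthogonal _ _).1 hy _ ⟨v, rfl⟩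
      simp only [LinearMap.sub_apply, LinearMap.id_apply, LinearMap.smul_apply,
        ContinuousLinearMap.coe_coe, ContinuousLinearMap.comp_apply, inner_sub_left,
        inner_smul_left, Complex.conj_ofReal] at h1
      rw [inner_zero_right, inner_sub_right, inner_smul_right, ← h1,
        ← ContinuousLinearMap.adjoint_inner_left J,
        ContinuousLinearMap.adjoint_inner_right J]
    have h2 := hw (ContinuousLinearMap.adjoint J y) (by
      rw [← map_smul, ← map_smul]
      exact congrArg _ (by rw [map_smul]; exact sub_eq_zero.1 hy0))
    rw [← inner_conj_symm, ← ContinuousLinearMap.adjoint_inner_right, h2, map_zero]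
  obtain ⟨y, hy⟩ := hmem
  have hy' : y - (c : ℂ) • J (ContinuousLinearMap.adjoint J y) = J w := hy
  -- The equation reads `p = w + c J* (J p)`, and `y` plays the part of `J p`.
  refine ⟨w + (c : ℂ) • ContinuousLinearMap.adjoint J y, ?_⟩
  have h3 : J (w + (c : ℂ) • ContinuousLinearMap.adjoint J y) = y := by
    rw [map_add, map_smul, ← hy']; abel
  rw [h3]; abel

end Adjoint

/-! ### Additivity of the index of a Hermitian form. -/

section IndexAddition

variable {K : Type*} [NormedAddCommGroup K] [InnerProductSpace ℂ K]

/-- The negative of the quadratic form of `M`. -/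
noncomputable def negForm (M : K →L[ℂ] K) (u : K) : ℝ := -(inner ℂ (M u) u).re

theorem negForm_zero (M : K →L[ℂ] K) : negForm M 0 = 0 := by simp [negForm]

variable {M : K →L[ℂ] K}

theorem inner_apply_eq_zero_comm (hM : M.IsSymmetric) {u v : K} (h : inner ℂ (M u) v = 0) :
    inner ℂ (M v) u = 0 := by
  have h1 : inner ℂ (M v) u = inner ℂ v (M u) := hM v u
  rw [h1, ← inner_conj_symm, h, map_zero]

theorem negForm_add (hM : M.IsSymmetric) {u v : K} (h : inner ℂ (M u) v = 0) :
    negForm M (u + v) = negForm M u + negForm M v := by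
  have h' := inner_apply_eq_zero_comm hM h
  simp only [negForm, map_add, inner_add_left, inner_add_right, h, h', Complex.add_re,
    Complex.zero_re]
  ring

theorem PosOn.sup (hM : M.IsSymmetric) {F F' : Submodule ℂ K} (hF : PosOn (negForm M) F)
    (hF' : PosOn (negForm M) F') (h : ∀ u ∈ F, ∀ v ∈ F', inner ℂ (M u) v = 0) :
    PosOn (negForm M) (F ⊔ F') := by
  intro x hx h0
  obtain ⟨u, hu, v, hv, rfl⟩ := Submodule.mem_sup.1 hx
  rw [negForm_add hM (h u hu v hv)]
  by_cases hu0 : u = 0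
  · rw [hu0, negForm_zero, zero_add]
    exact hF' v hv fun hv0 => h0 (by rw [hu0, hv0, add_zero])
  · by_cases hv0 : v = 0
    · rw [hv0, negForm_zero, add_zero]
      exact hF u hu hu0
    · exact add_pos (hF u hu hu0) (hF' v hv hv0)

theorem PosOn.disjoint {F F' : Submodule ℂ K} (hF : PosOn (negForm M) F)
    (h : ∀ u ∈ F, ∀ v ∈ F', inner ℂ (M u) v = 0) : Disjoint F F' := by
  rw [Submodule.disjoint_def]
  intro x hx hx'
  by_contra h0
  have h1 := hF x hx h0
  rw [negForm, h x hx x hx', Complex.zero_re, neg_zero] at h1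
  exact lt_irrefl _ h1

theorem posDims_subtype {V : Submodule ℂ K} {φ : K → ℝ} {n : ℕ∞} :
    n ∈ posDims (fun v : V => φ v) ↔ ∃ F ≤ V, PosOn φ F ∧ subspaceDim F = n := by
  constructor
  · rintro ⟨F, hF, rfl⟩
    refine ⟨F.map V.subtype, Submodule.map_subtype_le V F, ?_, ?_⟩
    · exact hF.map V.subtype fun x _ h => h
    · exact subspaceDim_map _ fun x _ h => Subtype.ext h
  · rintro ⟨F, hFV, hF, rfl⟩
    refine ⟨F.comap V.subtype, fun x hx h0 => hF x hx fun h => h0 (Subtype.ext h), ?_⟩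
    rw [← subspaceDim_map V.subtype fun x _ h => Subtype.ext h, Submodule.map_comap_subtype,
      inf_eq_right.2 hFV]

/-- A nonpositive subspace that meets the kernel of `M` trivially can be moved to a negative
one by a small step in the direction of `-M`. -/
theorem subspaceDim_mem_posDims (hM : M.IsSymmetric) {L : Submodule ℂ K}
    (hL : ∀ u ∈ L, 0 ≤ negForm M u) (hker : ∀ u ∈ L, M u = 0 → u = 0) :
    subspaceDim L ∈ posDims (negForm M) := by
  -- The step gains `2 ε ‖M u‖²` at first order; `ε ‖M‖ ≤ 1` keeps the second-order loss below half
  -- of that. The `+ 1` covers `M = 0`.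
  set ε : ℝ := (‖M‖ + 1)⁻¹ with hε
  have hε0 : 0 < ε := by positivity
  have hεM : ε * ‖M‖ ≤ 1 := by
    rw [hε, inv_mul_le_iff₀ (by positivity)]; linarith
  have key : ∀ u ∈ L, u ≠ 0 → 0 < negForm M (u - (ε : ℂ) • M u) := by
    intro u hu h0
    have hMu : 0 < ‖M u‖ := norm_pos_iff.2 fun h => h0 (hker u hu h)
    have h1 : inner ℂ (M (M u)) u = inner ℂ (M u) (M u) := hM (M u) u
    have h2 : (inner ℂ (M u) (M u)).re = ‖M u‖ ^ 2 := (norm_sq_eq_re_inner (𝕜 := ℂ) (M u)).symm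
    have h3 : negForm M (u - (ε : ℂ) • M u) =
        negForm M u + 2 * ε * ‖M u‖ ^ 2 - ε ^ 2 * (inner ℂ (M (M u)) (M u)).re := by
      simp only [negForm, map_sub, map_smul, inner_sub_left, inner_sub_right, inner_smul_left,
        inner_smul_right, Complex.conj_ofReal, h1, Complex.sub_re, Complex.re_ofReal_mul, h2]
      ring
    have h4 : (inner ℂ (M (M u)) (M u)).re ≤ ‖M‖ * ‖M u‖ ^ 2 := by
      refine (Complex.re_le_norm _).trans ((norm_inner_le_norm _ _).trans ?_)
      have := M.le_opNorm (M u)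
      nlinarith [norm_nonneg (M u)]
    have h5 : ε ^ 2 * (inner ℂ (M (M u)) (M u)).re ≤ ε * ‖M u‖ ^ 2 := by
      calc ε ^ 2 * (inner ℂ (M (M u)) (M u)).re ≤ ε ^ 2 * (‖M‖ * ‖M u‖ ^ 2) := by gcongr
        _ = ε * ‖M‖ * (ε * ‖M u‖ ^ 2) := by ring
        _ ≤ 1 * (ε * ‖M u‖ ^ 2) := by gcongr
        _ = _ := one_mul _
    have h6 : 0 < ε * ‖M u‖ ^ 2 := by positivity
    have h7 := hL u hu
    rw [h3]; linarith
  let f : K →ₗ[ℂ] K := LinearMap.id - (ε : ℂ) • M.toLinearMap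
  refine ⟨L.map f, ?_, subspaceDim_map f fun u hu h => ?_⟩
  · rintro _ ⟨u, hu, rfl⟩ h0
    exact key u hu fun h => h0 (by rw [h, map_zero])
  · by_contra h0
    have h1 : 0 < negForm M (f u) := key u hu h0
    rw [h, negForm_zero] at h1
    exact lt_irrefl _ h1

/-- Otherwise adjoining `p` to `F` would give a larger definite subspace of `V`; finiteness of `dim
F` makes the increase by one strict. -/
theorem negForm_nonpos_of_maximal (hM : M.IsSymmetric) {V F : Submodule ℂ K} (hFV : F ≤ V)
    (hF : PosOn (negForm M) F) (hfin : subspaceDim F < ⊤)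
    (hmax : ∀ F' ≤ V, PosOn (negForm M) F' → subspaceDim F' ≤ subspaceDim F)
    {p : K} (hp : p ∈ V) (hpF : ∀ v ∈ F, inner ℂ (M p) v = 0) : negForm M p ≤ 0 := by
  by_contra! hpos
  have hspan : PosOn (negForm M) (Submodule.span ℂ {p}) := by
    intro x hx h0
    obtain ⟨c, rfl⟩ := Submodule.mem_span_singleton.1 hx
    have hc : c ≠ 0 := fun h => h0 (by rw [h, zero_smul])
    have : negForm M (c • p) = ‖c‖ ^ 2 * negForm M p := by
      simp only [negForm, map_smul, inner_smul_left, inner_smul_right]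
      rw [← mul_assoc, mul_comm c, Complex.conj_mul', ← Complex.ofReal_pow,
        Complex.re_ofReal_mul, mul_neg]
    rw [this]
    have := norm_pos_iff.2 hc
    positivity
  have horth : ∀ u ∈ F, ∀ v ∈ Submodule.span ℂ {p}, inner ℂ (M u) v = 0 := by
    intro u hu v hv
    obtain ⟨c, rfl⟩ := Submodule.mem_span_singleton.1 hv
    rw [inner_smul_right, inner_apply_eq_zero_comm hM (hpF u hu), mul_zero]
  have h1 := hmax (F ⊔ Submodule.span ℂ {p})
    (sup_le hFV ((Submodule.span_singleton_le_iff_mem _ _).2 hp)) (hF.sup hM hspan horth)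
  have hp0 : p ≠ 0 := fun h => by rw [h, negForm_zero] at hpos; exact lt_irrefl _ hpos
  have h2 : subspaceDim (Submodule.span ℂ {p}) = 1 := by
    rw [subspaceDim, Cardinal.toENat_eq_one]
    exact Module.rank_eq_one_iff_finrank_eq_one.2 (finrank_span_singleton hp0)
  rw [subspaceDim_sup_of_disjoint (hF.disjoint horth), h2] at h1
  exact absurd h1 (not_le.2 ((ENat.lt_add_one_iff hfin.ne).2 le_rfl))

/-- The index of a Hermitian form is the sum of its indices on a subspace `V` and on the
orthogonal complement `G` of `V` with respect to the form, and of the dimension of a complement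
in `V ⊓ G` of the part where the form degenerates on the whole space. -/
theorem isGreatest_posDims_add (hM : M.IsSymmetric) {V G Z : Submodule ℂ K}
    (hG : ∀ u, u ∈ G ↔ ∀ v ∈ V, inner ℂ (M u) v = 0) (hZ : Z ≤ V ⊓ G)
    (hZM : ∀ z ∈ Z, M z = 0 → z = 0) (hVG : V ⊓ G ≤ Z ⊔ LinearMap.ker M.toLinearMap)
    (hrange : ∀ u, (∀ z ∈ V ⊓ G, inner ℂ (M u) z = 0) → u ∈ V ⊔ G) {m n : ℕ∞}
    (hm : IsGreatest (posDims fun v : V => negForm M v) m)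
    (hn : IsGreatest (posDims fun v : G => negForm M v) n) :
    IsGreatest (posDims (negForm M)) (m + subspaceDim Z + n) := by
  obtain ⟨Vm, hVmV, hVm, rfl⟩ := posDims_subtype.1 hm.1
  obtain ⟨Gm, hGmG, hGm, rfl⟩ := posDims_subtype.1 hn.1
  have hVmax : ∀ F' ≤ V, PosOn (negForm M) F' → subspaceDim F' ≤ subspaceDim Vm :=
    fun F' h h' => hm.2 (posDims_subtype.2 ⟨F', h, h', rfl⟩)
  have hGV : ∀ u ∈ G, ∀ v ∈ V, inner ℂ (M u) v = 0 := fun u hu => (hG u).1 hu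
  have hVG' : ∀ v ∈ V, ∀ u ∈ G, inner ℂ (M v) u = 0 := fun v hv u hu =>
    inner_apply_eq_zero_comm hM (hGV u hu v hv)
  constructor
  · have horth : ∀ u ∈ Vm, ∀ v ∈ Gm, inner ℂ (M u) v = 0 := fun u hu v hv =>
      hVG' u (hVmV hu) v (hGmG hv)
    have hW : PosOn (negForm M) (Vm ⊔ Gm) := hVm.sup hM hGm horth
    have hWZ : ∀ u ∈ Vm ⊔ Gm, ∀ z ∈ Z, inner ℂ (M u) z = 0 := by
      intro u hu z hz
      obtain ⟨v, hv, g, hg, rfl⟩ := Submodule.mem_sup.1 hu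
      rw [map_add, inner_add_left, hVG' v (hVmV hv) z (hZ hz).2, hGV g (hGmG hg) z (hZ hz).1,
        add_zero]
    have hzero : ∀ z ∈ Z, negForm M z = 0 := fun z hz => by
      rw [negForm, hVG' z (hZ hz).1 z (hZ hz).2, Complex.zero_re, neg_zero]
    have hdim : subspaceDim Vm + subspaceDim Z + subspaceDim Gm =
        subspaceDim ((Vm ⊔ Gm) ⊔ Z) := by
      rw [subspaceDim_sup_of_disjoint (hW.disjoint hWZ),
        subspaceDim_sup_of_disjoint (hVm.disjoint horth), add_right_comm]
    rw [hdim]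
    have hsum : ∀ u ∈ Vm ⊔ Gm, ∀ z ∈ Z, negForm M (u + z) = negForm M u := fun u hu z hz => by
      rw [negForm_add hM (hWZ u hu z hz), hzero z hz, add_zero]
    refine subspaceDim_mem_posDims hM (fun x hx => ?_) fun x hx hx0 => ?_
    · obtain ⟨u, hu, z, hz, rfl⟩ := Submodule.mem_sup.1 hx
      rw [hsum u hu z hz]
      by_cases h0 : u = 0
      · rw [h0, negForm_zero]
      · exact (hW u hu h0).le
    · obtain ⟨u, hu, z, hz, rfl⟩ := Submodule.mem_sup.1 hx
      -- The form at `u + z` equals the form at `u`, and it vanishes when `M (u + z) = 0`.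
      have hu0 : u = 0 := by
        by_contra h0
        have h1 := hW u hu h0
        rw [← hsum u hu z hz, negForm, hx0, inner_zero_left, Complex.zero_re, neg_zero] at h1
        exact lt_irrefl _ h1
      rw [hu0, zero_add] at hx0 ⊢
      exact hZM z hz hx0
  · rintro _ ⟨F, hF, rfl⟩
    by_cases hVfin : subspaceDim Vm < ⊤
    swap
    · rw [not_lt_top_iff.1 hVfin, top_add, top_add]; exact le_top
    by_cases hZfin : subspaceDim Z < ⊤
    swap
    · rw [not_lt_top_iff.1 hZfin, add_top, top_add]; exact le_top
    have := subspaceDim_lt_top_iff.1 hVfin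
    have := subspaceDim_lt_top_iff.1 hZfin
    -- `ker f` consists of the vectors orthogonal to `Vm ⊔ Z` for the form; this costs at most `dim
    -- Vm + dim Z` dimensions.
    let f : K →ₗ[ℂ] K := (Vm ⊔ Z).starProjection.toLinearMap ∘ₗ M.toLinearMap
    have hker : ∀ u, f u = 0 → ∀ v ∈ Vm ⊔ Z, inner ℂ (M u) v = 0 := by
      intro u hu v hv
      have h1 : M u ∈ (Vm ⊔ Z)ᗮ := by
        rw [← Submodule.ker_starProjection]
        exact hu
      exact Submodule.inner_left_of_mem_orthogonal hv h1
    have h1 := subspaceDim_le_ker_add (F := F) (F' := Vm ⊔ Z) f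
      fun x _ => Submodule.starProjection_apply_mem _ _
    set F₁ := F ⊓ LinearMap.ker f
    -- Orthogonality to `Z` extends to all of `V ⊓ G`, since the remaining part lies in `ker M` and
    -- `M` is symmetric.
    have hF₁ : F₁ ≤ V ⊔ G := by
      intro u hu
      refine hrange u fun z hz => ?_
      obtain ⟨z', hz', r, hr, rfl⟩ := Submodule.mem_sup.1 (hVG hz)
      have hr' : M r = 0 := hr
      have h2 : inner ℂ (M u) r = inner ℂ u (M r) := hM u r
      rw [inner_add_right, hker u hu.2 z' (le_sup_right (a := Vm) hz'), h2, hr', inner_zero_right,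
        add_zero]
    have h2 : subspaceDim F₁ ≤ subspaceDim Gm := by
      let Ψ : (V × G) →ₗ[ℂ] (V ⊔ G : Submodule ℂ K) :=
        (Submodule.inclusion le_sup_left).coprod (Submodule.inclusion le_sup_right)
      have hΨ : Function.Surjective Ψ := by
        rintro ⟨x, hx⟩
        obtain ⟨v, hv, g, hg, rfl⟩ := Submodule.mem_sup.1 hx
        exact ⟨(⟨v, hv⟩, ⟨g, hg⟩), Subtype.ext rfl⟩
      -- The decomposition along `V` and `G` is not unique when `V ⊓ G ≠ 0`, so a linear choice of
      -- components is fixed.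
      obtain ⟨s, hs⟩ := Module.projective_lifting_property Ψ (Submodule.inclusion hF₁) hΨ
      have hsum : ∀ u : F₁, ((s u).1 : K) + ((s u).2 : K) = u := fun u =>
        congrArg Subtype.val (LinearMap.congr_fun hs u)
      have hpos : ∀ u : F₁, u ≠ 0 → 0 < negForm M ((s u).2 : K) := by
        intro u hu
        have h3 : 0 < negForm M (u : K) := hF u u.2.1 fun h => hu (Subtype.ext h)
        -- The `G`-component is orthogonal to `V` for the form, so the `V`-component inherits
        -- orthogonality to `Vm` and maximality applies.
        have h4 : negForm M ((s u).1 : K) ≤ 0 := by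
          refine negForm_nonpos_of_maximal hM hVmV hVm hVfin hVmax (s u).1.2 fun v hv => ?_
          have h5 := hker u u.2.2 v (le_sup_left (b := Z) hv)
          rw [← hsum u, map_add, inner_add_left, hGV _ (s u).2.2 v (hVmV hv), add_zero] at h5
          exact h5
        rw [← hsum u, negForm_add hM (hVG' _ (s u).1.2 _ (s u).2.2)] at h3
        linarith
      let g : F₁ →ₗ[ℂ] G := LinearMap.snd ℂ V G ∘ₗ s
      have hg : PosOn (fun u : F₁ => negForm M (g u : K)) ⊤ := fun u _ => hpos u
      have h6 := hg.subspaceDim_map (ψ := fun v : G => negForm M v) g (fun _ _ h => h)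
        (negForm_zero M)
      have h7 : subspaceDim (⊤ : Submodule ℂ F₁) = subspaceDim F₁ := by
        rw [subspaceDim, subspaceDim, rank_top]
      rw [← h7, ← h6]
      exact hn.2 ⟨_, hg.map (ψ := fun v : G => negForm M v) g fun _ _ h => h, rfl⟩
    calc subspaceDim F ≤ subspaceDim F₁ + subspaceDim (Vm ⊔ Z) := h1
      _ ≤ subspaceDim Gm + (subspaceDim Vm + subspaceDim Z) :=
        add_le_add h2 (subspaceDim_sup_le _ _)
      _ = _ := add_comm _ _

end IndexAddition

/-! ### Operators generated by forms and Glazman's lemma. -/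

theorem mem_pmapEigenspace_iff {H : Type*} [NormedAddCommGroup H] [InnerProductSpace ℂ H]
    {A : H →ₗ.[ℂ] H} {z : ℂ} {x : H} :
    x ∈ pmapEigenspace A z ↔ (x, z • x) ∈ A.graph := by
  rw [LinearPMap.mem_graph_iff]
  constructor
  · rintro ⟨w, hw, rfl⟩
    exact ⟨w, rfl, sub_eq_zero.mp hw⟩
  · rintro ⟨w, hw, hw'⟩
    change (w : H) = x at hw
    subst hw
    exact ⟨w, sub_eq_zero.mpr hw', rfl⟩

namespace ClosedPosForm

variable {H : Type*} [NormedAddCommGroup H] [InnerProductSpace ℂ H] (a : ClosedPosForm H)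

theorem embed_injective : Function.Injective a.embed := fun _ _ h => Subtype.ext h

theorem mem_eigenspace_iff {z : ℂ} {u : a.Space} :
    a.embed u ∈ pmapEigenspace a.operator z ↔
      ∀ v : a.Space, inner ℂ u v = conj z * inner ℂ (a.embed u) (a.embed v) := by
  rw [mem_pmapEigenspace_iff, a.mem_graph_operator]
  simp only [inner_smul_left]
  constructor
  · rintro ⟨w, hw, hw'⟩
    rwa [a.embed_injective hw] at hw'
  · exact fun h => ⟨u, rfl, h⟩

theorem exists_embed_eq_of_mem_eigenspace {z : ℂ} {x : H}
    (hx : x ∈ pmapEigenspace a.operator z) : ∃ u, a.embed u = x := by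
  rw [mem_pmapEigenspace_iff, a.mem_graph_operator] at hx
  obtain ⟨u, hu, -⟩ := hx
  exact ⟨u, hu⟩

theorem inner_eq_zero_of_mem_eigenspace {lam : ℝ} {z : ℂ} (hz : z ≠ lam) {x y : H}
    (hx : x ∈ pmapEigenspace a.operator z) (hy : y ∈ pmapEigenspace a.operator lam) :
    inner ℂ x y = 0 := by
  obtain ⟨u, rfl⟩ := a.exists_embed_eq_of_mem_eigenspace hx
  obtain ⟨w, rfl⟩ := a.exists_embed_eq_of_mem_eigenspace hy
  have h1 := a.mem_eigenspace_iff.1 hx w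
  have h2 := a.mem_eigenspace_iff.1 hy u
  rw [← inner_conj_symm, h2, map_mul, Complex.conj_conj, inner_conj_symm] at h1
  have h3 : ((lam : ℂ) - conj z) * inner ℂ (a.embed u) (a.embed w) = 0 := by
    rw [sub_mul, h1, sub_self]
  refine (mul_eq_zero.1 h3).resolve_left fun h => hz ?_
  rw [← Complex.conj_conj z, ← sub_eq_zero.1 h, Complex.conj_ofReal]

variable [CompleteSpace H]

theorem isSelfAdjoint_inv : IsSelfAdjoint a.inv := by
  rw [ContinuousLinearMap.isSelfAdjoint_iff', inv, invToSpace, ContinuousLinearMap.adjoint_comp,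
    ContinuousLinearMap.adjoint_adjoint]

theorem re_inner_inv (y : H) : (inner ℂ (a.inv y) y).re = ‖a.invToSpace y‖ ^ 2 := by
  rw [norm_sq_eq_re_inner (𝕜 := ℂ)]
  change _ = (inner ℂ (a.invToSpace y) (ContinuousLinearMap.adjoint a.embed y)).re
  rw [ContinuousLinearMap.adjoint_inner_right]
  rfl

/-- Glazman's lemma: the counting function is the largest dimension of a subspace of the form
domain on which `a[u] < lam ‖u‖²`. -/
theorem isGreatest_counting (lam : ℝ) :
    IsGreatest (posDims fun u : a.Space => lam * ‖a.embed u‖ ^ 2 - ‖u‖ ^ 2)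
      (a.counting lam) := by
  rw [counting, spectralSubspaceBelow]
  split_ifs with h
  · rw [posDims_adjoint, ← posDims_mul_left (inv_pos.2 h)]
    have key := isGreatest_posDims_spectralSubspaceIoi a.isSelfAdjoint_inv lam⁻¹
    have hfun : (fun y : H => lam⁻¹ * (lam * ‖ContinuousLinearMap.adjoint a.embed y‖ ^ 2 -
        ‖y‖ ^ 2)) = fun y => (inner ℂ (a.inv y) y).re - lam⁻¹ * ‖y‖ ^ 2 := by
      funext y
      rw [a.re_inner_inv, mul_sub, inv_mul_cancel_left₀ h.ne']
      rfl
    rw [hfun]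
    exact key
  · rw [subspaceDim_bot]
    -- For `lam ≤ 0` the spectral subspace is `⊥` by definition, and no vector has positive value.
    exact isGreatest_posDims_of_nonpos fun u => by
      have := mul_nonneg (neg_nonneg.2 (not_lt.1 h)) (sq_nonneg ‖a.embed u‖)
      nlinarith [sq_nonneg ‖u‖]

/-- Substituting `x = A⁻¹ f` gives `(A - z) x = f - z A⁻¹ f`; this expresses closed range through a
bounded operator. -/
theorem pmapShiftRange_operator (z : ℂ) : pmapShiftRange a.operator z =
    LinearMap.range (LinearMap.id - z •
      (a.embed ∘L ContinuousLinearMap.adjoint a.embed).toLinearMap) := by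
  ext y
  constructor
  · rintro ⟨x, rfl⟩
    refine ⟨a.operator x, ?_⟩
    have := a.mem_graph_operator_iff_inv.1 (a.operator.mem_graph x)
    change a.operator x - z • a.inv (a.operator x) = a.operator x - z • (x : H)
    rw [this]
  · rintro ⟨f, rfl⟩
    have := a.mem_graph_operator_iff_inv.2 (rfl : a.inv f = a.inv f)
    obtain ⟨x, hx, hx'⟩ := (LinearPMap.mem_graph_iff _).1 this
    refine ⟨x, ?_⟩
    change a.operator x - z • (x : H) = f - z • a.inv f
    rw [hx']
    exact congrArg (fun w => f - z • w) hx

/-- The operator `1 - lam A⁻¹` in the form domain; its form is `a[u,v] - lam (u,v)`. -/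
noncomputable def shift (lam : ℝ) : a.Space →L[ℂ] a.Space :=
  ContinuousLinearMap.id ℂ a.Space - (lam : ℂ) • a.invOnSpace

theorem inner_invOnSpace (u v : a.Space) :
    inner ℂ (a.invOnSpace u) v = inner ℂ (a.embed u) (a.embed v) := by
  rw [invOnSpace, ContinuousLinearMap.comp_apply, invToSpace,
    ContinuousLinearMap.adjoint_inner_left]

theorem inner_shift (lam : ℝ) (u v : a.Space) :
    inner ℂ (a.shift lam u) v = inner ℂ u v - lam * inner ℂ (a.embed u) (a.embed v) := by
  change inner ℂ (u - (lam : ℂ) • a.invOnSpace u) v = _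
  rw [inner_sub_left, inner_smul_left, Complex.conj_ofReal, inner_invOnSpace]

theorem isSymmetric_shift (lam : ℝ) : (a.shift lam).IsSymmetric := by
  intro u v
  change inner ℂ (a.shift lam u) v = inner ℂ u (a.shift lam v)
  rw [← inner_conj_symm u, inner_shift, inner_shift, map_sub, map_mul, Complex.conj_ofReal,
    inner_conj_symm, inner_conj_symm]

theorem negForm_shift (lam : ℝ) (u : a.Space) :
    negForm (a.shift lam) u = lam * ‖a.embed u‖ ^ 2 - ‖u‖ ^ 2 := by
  rw [negForm, inner_shift, Complex.sub_re, Complex.re_ofReal_mul,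
    norm_sq_eq_re_inner (𝕜 := ℂ) u, norm_sq_eq_re_inner (𝕜 := ℂ) (a.embed u)]
  simp

theorem shift_apply_eq_zero_iff {lam : ℝ} {u : a.Space} :
    a.shift lam u = 0 ↔ a.embed u ∈ pmapEigenspace a.operator lam := by
  rw [a.mem_eigenspace_iff]
  constructor
  · intro h v
    have := a.inner_shift lam u v
    rw [h, inner_zero_left] at this
    rw [Complex.conj_ofReal]
    exact sub_eq_zero.1 this.symm
  · intro h
    refine ext_inner_right ℂ fun v => ?_
    rw [inner_shift, h v, Complex.conj_ofReal, sub_self, inner_zero_left]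

end ClosedPosForm

/-! ### The Dirichlet and Neumann operators of a form pair. -/

namespace FormPair

variable {H : Type*} [NormedAddCommGroup H] [InnerProductSpace ℂ H] (P : FormPair H)

/-- The inclusion of `H₀¹` in `H¹`. -/
noncomputable def incl : P.a₀.Space →ₗ[ℂ] P.a.Space :=
  Submodule.inclusion (p := P.H01.map P.a.embedₗ) (p' := P.a.domain) (by
    rintro _ ⟨u, -, rfl⟩
    exact Subtype.property u)

theorem embed_incl (u : P.a₀.Space) : P.a.embed (P.incl u) = P.a₀.embed u := rfl

theorem inner_incl (u v : P.a₀.Space) : inner ℂ (P.incl u) (P.incl v) = inner ℂ u v := rfl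

theorem norm_incl (u : P.a₀.Space) : ‖P.incl u‖ = ‖u‖ := by
  rw [@norm_eq_sqrt_re_inner ℂ, @norm_eq_sqrt_re_inner ℂ, inner_incl]

theorem incl_mem (u : P.a₀.Space) : P.incl u ∈ P.H01 := by
  obtain ⟨w, hw, hwu⟩ := Subtype.property u
  have : w = P.incl u := Subtype.ext hwu
  exact this ▸ hw

theorem exists_incl_eq {v : P.a.Space} (hv : v ∈ P.H01) : ∃ u, P.incl u = v :=
  ⟨⟨P.a.embedₗ v, v, hv, rfl⟩, Subtype.ext rfl⟩

/-- `incl` as an equivalence with `H₀¹`. -/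
noncomputable def inclEquiv : P.a₀.Space ≃ₗ[ℂ] P.H01 :=
  LinearEquiv.ofBijective (P.incl.codRestrict P.H01 P.incl_mem)
    ⟨fun _ _ h => P.a₀.embed_injective (congrArg (fun w : P.H01 => P.a.embed w) h),
      fun v => (P.exists_incl_eq v.2).imp fun _ h => Subtype.ext h⟩

theorem coe_inclEquiv (u : P.a₀.Space) : (P.inclEquiv u : P.a.Space) = P.incl u := rfl

theorem mem_eigenspace_AD_iff {z : ℂ} {x : H} : x ∈ pmapEigenspace P.AD z ↔
    ∃ u ∈ P.H01, P.a.embed u = x ∧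
      ∀ v ∈ P.H01, inner ℂ u v = conj z * inner ℂ (P.a.embed u) (P.a.embed v) := by
  constructor
  · intro hx
    obtain ⟨u, rfl⟩ := P.a₀.exists_embed_eq_of_mem_eigenspace hx
    refine ⟨P.incl u, P.incl_mem u, rfl, fun v hv => ?_⟩
    obtain ⟨v, rfl⟩ := P.exists_incl_eq hv
    exact P.a₀.mem_eigenspace_iff.1 hx v
  · rintro ⟨u, hu, rfl, h⟩
    obtain ⟨u, rfl⟩ := P.exists_incl_eq hu
    rw [embed_incl]
    exact P.a₀.mem_eigenspace_iff.2 fun v => h _ (P.incl_mem v)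

theorem mem_G_iff {lam : ℝ} {u : P.a.Space} : u ∈ P.G lam ↔
    ∀ v ∈ P.H01, inner ℂ u v = lam * inner ℂ (P.a.embed u) (P.a.embed v) := by
  rw [G, P.a.mem_G P.dense_H01]
  simp only [inner_smul_left, Complex.conj_ofReal]

theorem mem_eigenspace_AD_iff_inf {lam : ℝ} {u : P.a.Space} :
    P.a.embed u ∈ pmapEigenspace P.AD lam ↔ u ∈ P.H01 ⊓ P.G lam := by
  rw [mem_eigenspace_AD_iff, Submodule.mem_inf, mem_G_iff]
  simp only [Complex.conj_ofReal]
  constructor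
  · rintro ⟨w, hw, hwu, h⟩
    rw [P.a.embed_injective hwu] at h hw
    exact ⟨hw, h⟩
  · rintro ⟨hu, h⟩
    exact ⟨u, hu, rfl, h⟩

/-- A common eigenvector belongs to the same eigenvalue of both operators. -/
theorem eigenvalue_eq {z z' : ℂ} {x : H} (hx : x ≠ 0) (hN : x ∈ pmapEigenspace P.AN z)
    (hD : x ∈ pmapEigenspace P.AD z') : z = z' := by
  obtain ⟨u, hu, rfl, h⟩ := P.mem_eigenspace_AD_iff.1 hD
  have h' := P.a.mem_eigenspace_iff.1 hN
  -- Both eigenvalue identities can be tested against `H₀¹`, which is dense in `H`.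
  have h0 : (z - z') • P.a.embed u = 0 := by
    refine P.a.eq_zero_of_dense P.dense_H01 fun v hv => ?_
    rw [inner_smul_left, map_sub, sub_mul, ← h v hv, ← h' v, sub_self]
  exact sub_eq_zero.1 ((smul_eq_zero.1 h0).resolve_right hx)

/-- Common eigenvectors for other eigenvalues are orthogonal to `x` automatically, so only those for
`lam` need testing. -/
theorem mem_orthogonal_commonEigenspan {lam : ℝ} {x : H}
    (hx : x ∈ pmapEigenspace P.AD lam)
    (h : ∀ w, w ∈ pmapEigenspace P.AN lam → w ∈ pmapEigenspace P.AD lam → inner ℂ w x = 0) :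
    x ∈ (commonEigenspan P.AN P.AD)ᗮ := by
  rw [commonEigenspan, Submodule.orthogonal_closure, Submodule.mem_orthogonal]
  intro w hw
  induction hw using Submodule.span_induction with
  | mem w hw =>
    obtain ⟨h0, ⟨z, hz⟩, ⟨z', hz'⟩⟩ := hw
    obtain rfl := P.eigenvalue_eq h0 hz hz'
    by_cases hzl : z = lam
    · subst hzl
      exact h w hz hz'
    · exact P.a₀.inner_eq_zero_of_mem_eigenspace hzl hz' hx
  | zero => exact inner_zero_left _
  | add u v _ _ hu hv => rw [inner_add_left, hu, hv, add_zero]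
  | smul c u _ hu => rw [inner_smul_left, hu, mul_zero]

theorem mem_commonEigenspan {z : ℂ} {x : H} (hN : x ∈ pmapEigenspace P.AN z)
    (hD : x ∈ pmapEigenspace P.AD z) : x ∈ commonEigenspan P.AN P.AD := by
  by_cases h0 : x = 0
  · rw [h0]; exact zero_mem _
  · exact Submodule.le_topologicalClosure _ (Submodule.subset_span ⟨h0, ⟨z, hN⟩, ⟨z, hD⟩⟩)

variable [CompleteSpace H]

theorem isGreatest_ND (lam : ℝ) :
    IsGreatest (posDims fun v : P.H01 => negForm (P.a.shift lam) v) (P.ND lam) := by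
  have h := P.a₀.isGreatest_counting lam
  have hfun : ∀ u : P.a₀.Space, negForm (P.a.shift lam) (P.inclEquiv u : P.a.Space) =
      lam * ‖P.a₀.embed u‖ ^ 2 - ‖u‖ ^ 2 := fun u => by
    rw [coe_inclEquiv, P.a.negForm_shift, embed_incl, norm_incl]
  have heq : posDims (fun v : P.H01 => negForm (P.a.shift lam) v) =
      posDims fun u : P.a₀.Space => lam * ‖P.a₀.embed u‖ ^ 2 - ‖u‖ ^ 2 := by
    refine Set.Subset.antisymm (posDims_subset P.inclEquiv.symm.toLinearMap (fun v hv => ?_)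
      (by simp)) (posDims_subset P.inclEquiv.toLinearMap (fun u hu => ?_) ?_)
    · rw [← hfun]
      change 0 < negForm (P.a.shift lam) (P.inclEquiv (P.inclEquiv.symm v) : P.a.Space)
      rwa [LinearEquiv.apply_symm_apply]
    · rw [← hfun] at hu
      exact hu
    · exact negForm_zero _
  rw [heq]
  exact h

/-- The projection onto `G_lam` disappears when paired with a vector of `G_lam`, so `𝓑_lam` is the
compression of `shift lam`. -/
theorem inner_B (lam : ℝ) (u v : P.G lam) :
    inner ℂ (P.B lam u) v = inner ℂ (P.a.shift lam u) (v : P.a.Space) := by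
  have h := Submodule.inner_orthogonalProjectionOnto_eq_of_mem_right v
    (P.a.invOnSpace (u : P.a.Space))
  rw [Submodule.coe_inner, P.a.inner_invOnSpace] at h
  rw [Submodule.coe_inner]
  change inner ℂ ((u : P.a.Space) - (lam : ℂ) • ((P.G lam).orthogonalProjectionOnto
    (P.a.invOnSpace (u : P.a.Space)) : P.a.Space)) (v : P.a.Space) = _
  rw [inner_sub_left, inner_smul_left, h, P.a.inner_shift, Complex.conj_ofReal]

theorem isSelfAdjoint_B (lam : ℝ) : IsSelfAdjoint (P.B lam) := by
  rw [ContinuousLinearMap.isSelfAdjoint_iff_isSymmetric]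
  intro u v
  change inner ℂ (P.B lam u) v = inner ℂ u (P.B lam v)
  rw [← inner_conj_symm u, inner_B, inner_B, inner_conj_symm]
  exact P.a.isSymmetric_shift lam u v

theorem isGreatest_Gneg (lam : ℝ) :
    IsGreatest (posDims fun v : P.G lam => negForm (P.a.shift lam) v)
      (subspaceDim (P.Gneg lam)) := by
  have h := isGreatest_posDims_spectralSubspaceIio (P.isSelfAdjoint_B lam) 0
  have hfun : (fun v : P.G lam => negForm (P.a.shift lam) v) =
      fun v => 0 * ‖v‖ ^ 2 - (inner ℂ (P.B lam v) v).re := by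
    funext v
    rw [inner_B, negForm, zero_mul, zero_sub]
  rw [hfun]
  exact h

/-- One seeks `p ∈ H₀¹` with `u - p ∈ G_lam`, that is, `(1 - lam A_D⁻¹) p = ι* (M u)` in `H₀¹`,
where `M = shift lam` and `ι` is the inclusion of `H₀¹`. The kernel of the left-hand operator is
`H₀¹ ⊓ G_lam`, so `hu` is the solvability condition. -/
theorem mem_sup_of_isClosed_range {lam : ℝ}
    (hcl : IsClosed (pmapShiftRange P.AD (lam : ℂ) : Set H)) {u : P.a.Space}
    (hu : ∀ z ∈ P.H01 ⊓ P.G lam, inner ℂ (P.a.shift lam u) z = 0) : u ∈ P.H01 ⊔ P.G lam := by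
  rw [AD, P.a₀.pmapShiftRange_operator] at hcl
  let ι : P.a₀.Space →ₗᵢ[ℂ] P.a.Space := ⟨P.incl, P.norm_incl⟩
  have hι : ∀ w v, inner ℂ (ContinuousLinearMap.adjoint ι.toContinuousLinearMap w) v =
      inner ℂ w (P.incl v) := fun w v => ContinuousLinearMap.adjoint_inner_left _ _ _
  obtain ⟨p, hp⟩ := exists_eq_of_isClosed_range P.a₀.embed lam hcl
    (w := ContinuousLinearMap.adjoint ι.toContinuousLinearMap (P.a.shift lam u)) (by
      intro z hz
      rw [hι]
      refine hu _ ⟨P.incl_mem z, P.mem_G_iff.2 fun v hv => ?_⟩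
      obtain ⟨v, rfl⟩ := P.exists_incl_eq hv
      rw [inner_incl, embed_incl, embed_incl]
      nth_rewrite 1 [hz]
      rw [inner_smul_left, Complex.conj_ofReal, ContinuousLinearMap.adjoint_inner_left])
  refine Submodule.mem_sup.2 ⟨P.incl p, P.incl_mem p, u - P.incl p, ?_, by abel⟩
  refine P.mem_G_iff.2 fun v hv => ?_
  obtain ⟨v, rfl⟩ := P.exists_incl_eq hv
  have h1 := hι (P.a.shift lam u) v
  rw [← hp, P.a.inner_shift, inner_sub_left, inner_smul_left, Complex.conj_ofReal,
    ContinuousLinearMap.adjoint_inner_left, ← embed_incl, ← embed_incl, ← inner_incl] at h1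
  rw [map_sub, inner_sub_left, inner_sub_left, mul_sub]
  linear_combination -h1

/-- `E_D(lam)` fixes the common eigenvectors for `lam`, and its range is orthogonal to those for
other eigenvalues, so it maps `𝓗` into itself. Finite dimension makes the eigenspace closed. -/
theorem map_eigenProjection {lam : ℝ}
    (hfin : FiniteDimensional ℂ (pmapEigenspace P.AD (lam : ℂ))) :
    (commonEigenspan P.AN P.AD)ᗮ.map (eigenProjection P.AD (lam : ℂ)).toLinearMap =
      pmapEigenspace P.AD lam ⊓ (commonEigenspan P.AN P.AD)ᗮ := by
  have hcl := (Submodule.closed_of_finiteDimensional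
    (pmapEigenspace P.AD (lam : ℂ))).submodule_topologicalClosure_eq
  ext x
  constructor
  · rintro ⟨y, hy, rfl⟩
    have hmem : eigenProjection P.AD (lam : ℂ) y ∈ pmapEigenspace P.AD (lam : ℂ) := by
      have : eigenProjection P.AD (lam : ℂ) y ∈
          (pmapEigenspace P.AD (lam : ℂ)).topologicalClosure :=
        Submodule.starProjection_apply_mem _ _
      rwa [hcl] at this
    refine ⟨hmem, P.mem_orthogonal_commonEigenspan hmem fun w hN hD => ?_⟩
    have hw : w ∈ (pmapEigenspace P.AD (lam : ℂ)).topologicalClosure :=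
      Submodule.le_topologicalClosure _ hD
    change inner ℂ w ((pmapEigenspace P.AD (lam : ℂ)).topologicalClosure.starProjection y) = 0
    rw [← Submodule.inner_starProjection_left_eq_right,
      Submodule.starProjection_eq_self_iff.2 hw]
    exact Submodule.inner_right_of_mem_orthogonal (P.mem_commonEigenspan hN hD) hy
  · rintro ⟨hx, hx'⟩
    exact ⟨x, hx', Submodule.starProjection_eq_self_iff.2 (Submodule.le_topologicalClosure _ hx)⟩

theorem counting_eq {lam : ℝ} (hfin : FiniteDimensional ℂ (pmapEigenspace P.AD (lam : ℂ)))
    (hcl : IsClosed (pmapShiftRange P.AD (lam : ℂ) : Set H)) :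
    P.NN lam = P.ND lam + P.nD lam + subspaceDim (P.Gneg lam) := by
  have hNN : IsGreatest (posDims (negForm (P.a.shift lam))) (P.NN lam) := by
    have hfun : negForm (P.a.shift lam) =
        fun u : P.a.Space => lam * ‖P.a.embed u‖ ^ 2 - ‖u‖ ^ 2 :=
      funext (P.a.negForm_shift lam)
    rw [hfun]
    exact P.a.isGreatest_counting lam
  set ZH : Submodule ℂ H := pmapEigenspace P.AD lam ⊓ (commonEigenspan P.AN P.AD)ᗮ with hZH
  set Z : Submodule ℂ P.a.Space := ZH.comap P.a.embed.toLinearMap with hZ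
  have hnD : P.nD lam = subspaceDim Z := by
    rw [nD, P.map_eigenProjection hfin, ← hZH,
      ← subspaceDim_map P.a.embed.toLinearMap fun x _ h => P.a.embed_injective
        (h.trans (map_zero P.a.embed).symm), hZ, Submodule.map_comap_eq, inf_eq_right.2]
    rintro x ⟨hx, -⟩
    obtain ⟨u, -, hu, -⟩ := P.mem_eigenspace_AD_iff.1 hx
    exact ⟨u, hu⟩
  rw [hnD]
  refine hNN.unique (isGreatest_posDims_add (Z := Z) (P.a.isSymmetric_shift lam) (fun u => ?_)
    (fun u hu => P.mem_eigenspace_AD_iff_inf.1 hu.1) (fun u hu h0 => ?_) (fun u hu => ?_)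
    (fun u hu => P.mem_sup_of_isClosed_range hcl hu) (P.isGreatest_ND lam)
    (P.isGreatest_Gneg lam))
  · simp only [P.mem_G_iff, P.a.inner_shift, sub_eq_zero]
  · have hN := P.a.shift_apply_eq_zero_iff.1 h0
    have h1 : inner ℂ (P.a.embed u) (P.a.embed u) = 0 :=
      Submodule.inner_right_of_mem_orthogonal (P.mem_commonEigenspan hN hu.1) hu.2
    exact P.a.embed_injective ((inner_self_eq_zero.1 h1).trans (map_zero P.a.embed).symm)
  · have hD := P.mem_eigenspace_AD_iff_inf.2 hu
    -- Subtracting the projection onto the common eigenspace `W` for `lam` leaves a vector of `Z`;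
    -- the projection itself lies in the kernel of `shift lam`.
    set W : Submodule ℂ H := pmapEigenspace P.AD lam ⊓ pmapEigenspace P.AN lam
    have : FiniteDimensional ℂ W := Submodule.finiteDimensional_inf_left _ _
    have hW : W.starProjection (P.a.embed u) ∈ W := Submodule.starProjection_apply_mem _ _
    obtain ⟨w, hw⟩ := P.a.exists_embed_eq_of_mem_eigenspace hW.2
    refine Submodule.mem_sup.2 ⟨u - w, ?_, w, ?_, sub_add_cancel u w⟩
    · have hmem : P.a.embed (u - w) ∈ pmapEigenspace P.AD (lam : ℂ) := by
        rw [map_sub, hw]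
        exact sub_mem hD hW.1
      refine ⟨hmem, P.mem_orthogonal_commonEigenspan hmem fun y hN hD' => ?_⟩
      change inner ℂ y (P.a.embed (u - w)) = 0
      rw [map_sub, hw]
      exact Submodule.inner_right_of_mem_orthogonal (K := W) ⟨hD', hN⟩
        (Submodule.sub_starProjection_mem_orthogonal _)
    · refine P.a.shift_apply_eq_zero_iff.2 ?_
      rw [hw]
      exact hW.2

end FormPair

theorem mainTheorem1 {H : Type*} [NormedAddCommGroup H] [InnerProductSpace ℂ H] [CompleteSpace H]
    (P : FormPair H) (lam : ℝ) (hlam : (lam : EReal) < infEssSpectrum P.AD) :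
    P.NN lam = P.ND lam + P.nD lam + subspaceDim (P.Gneg lam) := by
  -- A point strictly below the infimum is outside the essential spectrum, so `A_D - lam` is
  -- Fredholm.
  have h : lam ∉ essSpectrum P.AD := fun h =>
    absurd (sInf_le (Set.mem_image_of_mem _ h)) (not_le.2 hlam)
  rw [essSpectrum, Set.mem_ofPred_eq, not_not] at h
  exact P.counting_eq h.1 h.2.1
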